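/- **Theorem (ε-corrector for cycle-freeness).** In the randomized CONGEST model the processors are the vertices of an $n$-vertex graph $G=(V,E)$ (not necessarily connected) and the edges are the communication links. Every processor knows $n$ and $\varepsilon$, its own identifier, its degree and a private string of independent fair random bits, and its links are numbered arbitrarily. The identifiers are distinct integers in $\{0,\dots,n^{\kappa}-1\}$. Computation proceeds in synchronous rounds; in each round each processor performs unrestricted local computation and sends to each neighbour a (possibly different) message of $O(\log n)$ bits. Let $\mathrm{dist}(G,\text{acyclic})$ denote the minimum number of edges whose removal from $G$ leaves an acyclic graph. For all $\kappa,c\in\mathbb{N}$ there is a constant $C>0$ (depending only on $\kappa$ and $c$) such that for every $n$ and every $\varepsilon>0$ there is a randomized CONGEST algorithm with at most $C\,\frac{\log n}{\varepsilon}$ rounds and messages of at most $C\log n$ bits that is an $\varepsilon$-corrector for cycle-freeness with high probability. That is, on every $n$-vertex network $G=(V,E)$ the following hold together, for one set $D\subseteq E$, with probability at least $1-n^{-c}$: 1. when the algorithm terminates, every processor $v$ knows (outputs) which of the edges incident to $v$ belong to $D$; 2. the remaining graph $(V,E\setminus D)$ is acyclic; 3. $|D|\le \mathrm{dist}(G,\text{acyclic})+\varepsilon|E|$;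 4. there are a partition of $V$ into clusters $V_1,\dots,V_k$, each inducing a connected subgraph $G[V_i]$ of diameter at most $C\,\frac{\log n}{\varepsilon}$, and a spanning tree $T_i$ of each $G[V_i]$, such that $D$ consists exactly of all cut edges (edges with ends in different clusters) and all edges inside a cluster $V_i$ that are not edges of $T_i$. -/

import Mathlib

universe u

/-! ### The randomized CONGEST model -/

/-- A synchronous randomized message-passing algorithm, the same program at every processor.
A processor starts with its identifier, its degree and its own finite tape of private random bits;
its links are numbered `0, …, degree - 1` (its ports). In every round each processor first computes
(for each port) a message, a bit string, from its local state; all messages are delivered, and each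
processor updates its state. The empty string is the empty message. After `rounds` rounds each
processor outputs one bit for each of its ports. Local computation is not restricted. -/
structure CongestAlgorithm where
  tapeLength : ℕ
  State : Type
  init : (ident degree : ℕ) → (Fin tapeLength → Bool) → State
  send : State → (port : ℕ) → List Bool
  receive : State → (inbox : ℕ → List Bool) → State
  rounds : ℕ
  output : State → (port : ℕ) → Bool

/-- Every message has at most `b` bits. -/
def CongestAlgorithm.BandwidthAtMost (A : CongestAlgorithm) (b : ℝ) : Prop :=
  ∀ (s : A.State) (p : ℕ), ((A.send s p).length : ℝ) ≤ b

/-- A network: a graph whose vertices are the processors and whose edges are the links, an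
arbitrary numbering of the links at each processor, and distinct identifiers. -/
structure Network (V : Type u) where
  graph : SimpleGraph V
  port : ∀ v : V, Fin (graph.neighborSet v).ncard ≃ graph.neighborSet v
  ident : V → ℕ
  ident_injective : Function.Injective ident

namespace Network

variable {V : Type u} (N : Network V)

/-- The number of links at `v`. -/
noncomputable def degree (v : V) : ℕ := (N.graph.neighborSet v).ncard

/-- If every `u` sends `out u p` through its port `p`, then `N.inbox out v p` is what `v` receives
through its port `p`: the message that the neighbour `u` at that port sends through the port of `u`
which leads to `v`. -/
noncomputable def inbox (out : V → ℕ → List Bool) (v : V) (p : ℕ) : List Bool :=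
  if h : p < (N.graph.neighborSet v).ncard then
    out (N.port v ⟨p, h⟩)
      ((N.port (N.port v ⟨p, h⟩)).symm ⟨v, (N.port v ⟨p, h⟩).2.symm⟩ : Fin _)
  else []

end Network

namespace CongestAlgorithm

variable {V : Type u} (A : CongestAlgorithm) (N : Network V)

/-- The states of all processors after a number of rounds, for given private random tapes. -/
noncomputable def stateAfter (tape : V → Fin A.tapeLength → Bool) : ℕ → V → A.State
  | 0, v => A.init (N.ident v) (N.degree v) (tape v)
  | t + 1, v => A.receive (stateAfter tape t v)
      (N.inbox (fun u => A.send (stateAfter tape t u)) v)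

/-- The final output of the processor `v` at its port `p`. -/
noncomputable def finalOutput (tape : V → Fin A.tapeLength → Bool) (v : V) (p : ℕ) : Bool :=
  A.output (A.stateAfter N tape A.rounds v) p

/-- The probability of an event when all bits of all tapes are independent and fair. -/
noncomputable def tapeProb (event : Set (V → Fin A.tapeLength → Bool)) : ℝ :=
  (event.ncard : ℝ) / (Nat.card (V → Fin A.tapeLength → Bool) : ℝ)

end CongestAlgorithm

/-! ### Graph properties and correction -/

/-- A graph property. -/
def GraphProperty : Type (u + 1) := (V : Type u) → SimpleGraph V → Prop

/-- A property that is preserved by the removal of edges. -/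
def GraphProperty.EdgeMonotone (P : GraphProperty.{u}) : Prop :=
  ∀ (V : Type u) (G G' : SimpleGraph V), G' ≤ G → P V G → P V G'

/-- Cycle-freeness. -/
def CycleFree : GraphProperty.{u} := fun _ G => G.IsAcyclic

theorem cycleFree_edgeMonotone : CycleFree.{u}.EdgeMonotone :=
  fun _ _ _ hle h => SimpleGraph.IsAcyclic.anti hle h

/-- The minimum number of edges that have to be removed from `G` to obtain the property `P`. -/
noncomputable def deletionDist {V : Type u} (P : GraphProperty.{u}) (G : SimpleGraph V) : ℕ :=
  sInf {k : ℕ | ∃ D : Set (Sym2 V), D ⊆ G.edgeSet ∧ P V (G.deleteEdges D) ∧ D.ncard = k}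

/-- For the given random tapes, the run of `A` on the network satisfies the requirements of an
`ε`-corrector for `P` with deleted edge set `D`: every processor outputs which of the edges at it
belong to `D` (so the two ends of an edge agree), the remaining graph has the property, and `D` has
at most `ε |E|` edges more than necessary. -/
def CongestAlgorithm.Corrects {V : Type u} (A : CongestAlgorithm) (N : Network V)
    (P : GraphProperty.{u}) (ε : ℝ) (tape : V → Fin A.tapeLength → Bool)
    (D : Set (Sym2 V)) : Prop :=
  D ⊆ N.graph.edgeSet ∧
  (∀ (v : V) (i : Fin (N.graph.neighborSet v).ncard),
    A.finalOutput N tape v i = true ↔ s(v, (N.port v i : V)) ∈ D) ∧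
  P V (N.graph.deleteEdges D) ∧
  (D.ncard : ℝ) ≤ (deletionDist P N.graph : ℝ) + ε * (N.graph.edgeSet.ncard : ℝ)

/-! ### Clusterings -/

/-- A partition `𝒱` of the vertices into clusters which induce connected subgraphs of diameter at
most `d` (distances are measured inside the cluster). -/
def IsClustering {V : Type u} (G : SimpleGraph V) (𝒱 : Set (Set V)) (d : ℝ) : Prop :=
  Setoid.IsPartition 𝒱 ∧
  ∀ S ∈ 𝒱, (G.induce S).Connected ∧ ∀ u v : S, ((G.induce S).dist u v : ℝ) ≤ d

/-- The edges inside some cluster. -/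
def intraEdges {V : Type u} (G : SimpleGraph V) (𝒱 : Set (Set V)) : Set (Sym2 V) :=
  {e ∈ G.edgeSet | ∃ S ∈ 𝒱, ∀ x ∈ e, x ∈ S}

/-- The cut edges: those with ends in different clusters. -/
def cutEdges {V : Type u} (G : SimpleGraph V) (𝒱 : Set (Set V)) : Set (Sym2 V) :=
  G.edgeSet \ intraEdges G 𝒱

/-- `D` consists of the cut edges of a clustering with diameter at most `d` and of all edges inside
the clusters that do not belong to a chosen spanning tree `T[S]` of the cluster `S`. -/
def IsClusterTreeDeletion {V : Type u} (G : SimpleGraph V) (d : ℝ) (D : Set (Sym2 V)) : Prop :=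
  ∃ (𝒱 : Set (Set V)) (T : SimpleGraph V), IsClustering G 𝒱 d ∧
    T ≤ G ∧ (∀ S ∈ 𝒱, (T.induce S).IsTree) ∧
    D = cutEdges G 𝒱 ∪ (intraEdges G 𝒱 \ T.edgeSet)

/-! The corrector is deterministic, so its guarantees hold with probability 1. Let `ρ = ⌈1/ε⌉`, `r =
2ρ`, and let `L = κ (Nat.log 2 n + 1)` bound the number of bits of an identifier. The bits yield a
ruling set `R`: its elements are more than `r` apart, yet every vertex is within `L * r` of `R`
(`rulingSet_separated`, `mem_within_rulingSet`). Breadth-first trees grown from `R` have depth at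
most `L * r`; they are the clusters, and all edges outside them are deleted.

Let `k` be the number of components. The forest keeps at least `n - |R|` edges, while an acyclic
subgraph has at most `n - k`, so at most `|R| - k` edges too many are deleted. In each component fix
one element of `R`, if there is one. Every other element owns the first `ρ` edges of a geodesic to
the fixed one, and by separation these edge sets are disjoint. Hence `(|R| - k) ρ ≤ |E|`
(`ncard_mul_le_of_separated`), and the excess is at most `ε |E|`.

It remains to show that the distributed run computes this forest. An invariant of the floods
(`FloodInvariant`) does this, and `IsParentMap` passes from parent pointers to graph theory. -/

/-! ### Neighbourhoods of a set of vertices -/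

namespace SimpleGraph

variable {V : Type u} {G : SimpleGraph V}

/-- The vertices at distance at most `k` from `X`. -/
def within (G : SimpleGraph V) (X : Set V) : ℕ → Set V
  | 0 => X
  | k + 1 => {v | v ∈ G.within X k ∨ ∃ w, G.Adj v w ∧ w ∈ G.within X k}

theorem within_mono (X : Set V) : Monotone (G.within X) :=
  monotone_nat_of_le_succ fun _ _ hv => Or.inl hv

theorem within_within (X : Set V) (k l : ℕ) :
    G.within (G.within X k) l = G.within X (k + l) := by
  induction l with
  | zero => rfl
  | succ l ih =>
    change {v | _ ∨ _} = {v | _ ∨ _}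
    rw [ih]
    rfl

theorem within_subset_within {X Y : Set V} (h : X ⊆ Y) (k : ℕ) :
    G.within X k ⊆ G.within Y k := by
  induction k with
  | zero => exact h
  | succ k ih =>
    rintro v (hv | ⟨w, hw, hwX⟩)
    · exact Or.inl (ih hv)
    · exact Or.inr ⟨w, hw, ih hwX⟩

theorem Walk.mem_within {X : Set V} {u v : V} (p : G.Walk u v) (hv : v ∈ X) :
    u ∈ G.within X p.length := by
  induction p with
  | nil => exact hv
  | cons h p ih => exact Or.inr ⟨_, h, ih hv⟩

/-! ### Counting edges -/

/-- An acyclic graph has at most as many edges as it has vertices minus components. -/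
theorem IsAcyclic.ncard_edgeSet_add_card_le [Finite V] (h : G.IsAcyclic) :
    G.edgeSet.ncard + Nat.card G.ConnectedComponent ≤ Nat.card V := by
  classical
  let rep : V → V := fun v => (G.connectedComponentMk v).out
  have hrep : ∀ v, G.Reachable v (rep v) := fun v =>
    (ConnectedComponent.exact (Quot.out_eq (G.connectedComponentMk v))).symm
  have hpath : ∀ v, ∃ p : G.Walk v (rep v), p.IsPath := fun v =>
    ⟨_, (hrep v).some.toPath.2⟩
  choose p hp using hpath
  let R : Set V := Set.range (Quot.out : G.ConnectedComponent → V)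
  have hR : R.ncard = Nat.card G.ConnectedComponent :=
    Set.ncard_range_of_injective fun a b hab => by
      rw [← Quot.out_eq a, hab, Quot.out_eq]
  -- Each edge is charged to an end whose path to its root passes through the other end. The edge is
  -- then the first one of that path, so a non-root is charged at most once and a root never.
  have key : ∀ a b, G.Adj a b → b ∈ (p a).support →
      ∃ v ∈ Rᶜ, s(v, (p v).snd) = s(a, b) := by
    intro a b hab hb
    refine ⟨a, ?_, by rw [← h.eq_snd_of_adj_start (hp a) hab hb]⟩
    rintro ⟨C, rfl⟩
    have hC : rep (Quot.out C) = Quot.out C := by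
      have : G.connectedComponentMk (Quot.out C) = C := Quot.out_eq C
      simp only [rep, this]
    generalize hq : p (Quot.out C) = q at hb
    have hqp : q.IsPath := hq ▸ hp _
    clear hq
    revert q
    rw [hC]
    intro q hb hq
    rw [Walk.nil_iff_support_eq.1 (Walk.isPath_iff_nil.1 hq), List.mem_singleton] at hb
    exact hab.ne hb.symm
  have hsub : G.edgeSet ⊆ (fun v => s(v, (p v).snd)) '' Rᶜ := by
    intro e
    induction e with | _ a b
    intro hab
    rw [mem_edgeSet] at hab
    by_cases hb : b ∈ (p a).support
    · exact key a b hab hb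
    · have hrab : rep a = rep b := by
        simp only [rep, ConnectedComponent.sound hab.reachable]
      have hmem : ∀ r (q : G.Walk a r) (q' : G.Walk b r), q.IsPath → q'.IsPath →
          b ∉ q.support → a ∈ q'.support := by
        intro r q q' hq hq' hbq
        have := (h.subsingleton_path b r).elim ⟨q', hq'⟩ ⟨q.cons hab.symm, hq.cons hbq⟩
        have h2 : q' = q.cons hab.symm := congrArg Subtype.val this
        rw [h2]
        simp
      have ha : a ∈ (p b).support := by
        have := hmem (rep b) ((p a).copy rfl hrab) (p b) (by simpa using hp a) (hp b)
          (by simpa using hb)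
        exact this
      obtain ⟨v, hv, he⟩ := key b a hab.symm ha
      exact ⟨v, hv, he.trans Sym2.eq_swap⟩
  have h1 := Set.ncard_le_ncard hsub
  have h2 : ((fun v => s(v, (p v).snd)) '' Rᶜ).ncard ≤ Rᶜ.ncard := Set.ncard_image_le
  have h3 := Set.ncard_add_ncard_compl R
  omega

/-- If the elements of `S` are more than `2 ρ` apart from each other, then each of them but one
for each component has `ρ` edges of its own. -/
theorem ncard_mul_le_of_separated [Finite V] {S : Set V} {ρ : ℕ}
    (hS : ∀ u ∈ S, ∀ v ∈ S, u ≠ v → ∀ p : G.Walk u v, 2 * ρ < p.length) :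
    (S.ncard - Nat.card G.ConnectedComponent) * ρ ≤ G.edgeSet.ncard := by
  classical
  -- One element of `S` is set aside in each component that meets `S`; the value elsewhere is
  -- irrelevant.
  let f : G.ConnectedComponent → V := fun C =>
    if h : ∃ s ∈ S, G.connectedComponentMk s = C then h.choose else C.out
  have hf : ∀ s ∈ S, f (G.connectedComponentMk s) ∈ S ∧
      G.Reachable s (f (G.connectedComponentMk s)) := by
    intro s hs
    have h : ∃ s' ∈ S, G.connectedComponentMk s' = G.connectedComponentMk s := ⟨s, hs, rfl⟩
    have h2 : f (G.connectedComponentMk s) = h.choose := dif_pos h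
    rw [h2]
    exact ⟨h.choose_spec.1, (ConnectedComponent.exact h.choose_spec.2).symm⟩
  let S' : Set V := S \ Set.range f
  have hS' : S.ncard - Nat.card G.ConnectedComponent ≤ S'.ncard := by
    have h1 : (Set.range f).ncard ≤ Nat.card G.ConnectedComponent := by
      rw [← Set.image_univ, ← Set.ncard_univ]
      exact Set.ncard_image_le
    have h2 : _ ≤ S'.ncard := Set.le_ncard_sdiff (Set.range f) S
    omega
  have hpath : ∀ s : S', ∃ (t : V) (p : G.Walk s t), p.length = G.dist s t ∧
      2 * ρ < p.length := by
    rintro ⟨s, hs, hsf⟩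
    obtain ⟨hfS, hr⟩ := hf s hs
    obtain ⟨p, hp⟩ := hr.exists_walk_length_eq_dist
    exact ⟨_, p, hp, hS s hs _ hfS (fun h => hsf ⟨_, h.symm⟩) p⟩
  choose t p hp hlen using hpath
  have hdist : ∀ (s : S') i, i ≤ ρ → G.dist s ((p s).getVert i) = i := by
    intro s i hi
    have hl := hlen s
    have h1 := dist_le ((p s).take i)
    have h2 := dist_le ((p s).drop i)
    rw [Walk.take_length] at h1
    rw [Walk.drop_length] at h2
    have h3 := ((p s).take i).reachable.dist_triangle_left (t s)
    have h4 := hp s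
    omega
  -- Initial segments of length at most `ρ` from different starts cannot meet: together they would
  -- form a walk of length at most `2 * ρ`. Within one segment, positions are distances from the
  -- start.
  have heq : ∀ (s s' : S') (i j : ℕ), i ≤ ρ → j ≤ ρ →
      (p s).getVert i = (p s').getVert j → s = s' ∧ i = j := by
    intro s s' i j hi hj h
    have hss : s = s' := by
      by_contra hne
      have := hS s s.2.1 s' s'.2.1 (fun h => hne (Subtype.ext h))
        (((p s).take i).append (((p s').take j).reverse.copy h.symm rfl))
      rw [Walk.length_append, Walk.length_copy, Walk.length_reverse, Walk.take_length,
        Walk.take_length] at this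
      omega
    subst hss
    refine ⟨rfl, ?_⟩
    rw [← hdist s i hi, h, hdist s j hj]
  let E : S' × Fin ρ → G.edgeSet := fun x =>
    ⟨s((p x.1).getVert x.2, (p x.1).getVert (x.2 + 1)),
      (p x.1).adj_getVert_succ (by have := hlen x.1; have := x.2.2; omega)⟩
  have hE : Function.Injective E := by
    rintro ⟨s, i⟩ ⟨s', j⟩ h
    have hi := i.2
    have hj := j.2
    have h' : s((p s).getVert i, (p s).getVert (i + 1)) =
      s((p s').getVert j, (p s').getVert (j + 1)) := congrArg Subtype.val h
    rw [Sym2.eq_iff] at h'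
    rcases h' with ⟨h1, -⟩ | ⟨h1, h2⟩
    · obtain ⟨rfl, hij⟩ := heq s s' i j hi.le hj.le h1
      rw [Fin.ext hij]
    · have h3 := (heq s s' i (j + 1) hi.le hj h1).2
      have h4 := (heq s s' (i + 1) j hi hj.le h2).2
      omega
  have := Nat.card_le_card_of_injective E hE
  rw [Nat.card_prod, Nat.card_coe_set_eq, Nat.card_coe_set_eq, Nat.card_fin] at this
  exact (Nat.mul_le_mul_right ρ hS').trans this

/-! ### Forests of parent pointers -/

/-- The graph that joins every vertex to its parent. -/
def parentGraph (par : V → V) : SimpleGraph V := fromRel fun v w => par v = w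

/-- Every vertex which is not its own parent is adjacent to its parent, and its level is larger. -/
def IsParentMap (G : SimpleGraph V) (par : V → V) (lev : V → ℕ) : Prop :=
  ∀ v, par v ≠ v → G.Adj v (par v) ∧ lev (par v) < lev v

namespace IsParentMap

variable {par : V → V} {lev : V → ℕ} {B : ℕ}

theorem par_iterate (h : G.IsParentMap par lev) (i : ℕ) :
    ∀ v, lev v ≤ i → par (par^[i] v) = par^[i] v := by
  induction i with
  | zero =>
    intro v hv
    by_contra hne
    have := (h v hne).2
    omega
  | succ i ih =>
    intro v hv
    rw [Function.iterate_succ_apply]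
    by_cases hp : par v = v
    · rw [hp, Function.iterate_fixed hp, hp]
    · exact ih _ (by have := (h v hp).2; omega)

/-- Levels drop along parent pointers, so `par^[B] v` is the root of the tree of `v` and serves as
the label of its cluster. -/
theorem iterate_par (h : G.IsParentMap par lev) (hB : ∀ v, lev v ≤ B) (v : V) :
    par^[B] (par v) = par^[B] v := by
  rw [← Function.iterate_succ_apply, Function.iterate_succ_apply', h.par_iterate B v (hB v)]

theorem parentGraph_le (h : G.IsParentMap par lev) : parentGraph par ≤ G := by
  rintro v w ⟨hne, rfl | rfl⟩
  · exact (h v hne.symm).1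
  · exact (h w hne).1.symm

theorem iterate_eq_of_adj (h : G.IsParentMap par lev) (hB : ∀ v, lev v ≤ B) {v w : V}
    (hvw : (parentGraph par).Adj v w) : par^[B] v = par^[B] w := by
  obtain ⟨-, rfl | rfl⟩ := hvw
  · exact (h.iterate_par hB v).symm
  · exact h.iterate_par hB w

/-- At a vertex of maximal level on a cycle, both neighbours along the cycle would have to be its
parent, hence would coincide. -/
theorem isAcyclic (h : G.IsParentMap par lev) : (parentGraph par).IsAcyclic := by
  classical
  intro v c hc
  obtain ⟨x, hx, hmax⟩ := c.support.toFinset.exists_max_image lev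
    ⟨v, by simp⟩
  rw [List.mem_toFinset] at hx
  have hc' := hc.rotate hx
  have hpar : ∀ y ∈ (c.rotate x hx).support, (parentGraph par).Adj x y → par x = y := by
    rintro y hy ⟨hne, hxy | hyx⟩
    · exact hxy
    · have h1 := (h y (by rw [hyx]; exact hne)).2
      have h2 := hmax y (by
        rw [List.mem_toFinset]
        exact (Walk.mem_support_rotate_iff ..).1 hy)
      rw [hyx] at h1
      omega
  apply hc'.snd_ne_penultimate
  exact (hpar _ (Walk.getVert_mem_support _ _) (Walk.adj_snd hc'.not_nil)).symm.trans
    (hpar _ (Walk.getVert_mem_support _ _) (Walk.adj_penultimate hc'.not_nil).symm)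

/-- Every vertex of a tree of the forest is joined to the root inside the tree. -/
theorem exists_walk_root (h : G.IsParentMap par lev) (hB : ∀ v, lev v ≤ B) {x : V}
    (hx : par^[B] x = x) (k : ℕ) :
    ∀ v : {w | par^[B] w = x}, lev v ≤ k →
      ∃ p : ((parentGraph par).induce {w | par^[B] w = x}).Walk v ⟨x, hx⟩, p.length ≤ k := by
  induction k with
  | zero =>
    rintro ⟨v, hv⟩ hl
    have hp : par v = v := by
      by_contra hne
      exact absurd (h v hne).2 (by simp only at hl; omega)
    obtain rfl : v = x := by rw [← hv, Function.iterate_fixed hp]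
    exact ⟨Walk.nil, le_rfl⟩
  | succ k ih =>
    rintro ⟨v, hv⟩ hl
    by_cases hp : par v = v
    · obtain rfl : v = x := by rw [← hv, Function.iterate_fixed hp]
      exact ⟨Walk.nil, Nat.zero_le _⟩
    · obtain ⟨p, hpl⟩ := ih ⟨par v, (h.iterate_par hB v).trans hv⟩
        (by have := (h v hp).2; simp only at hl ⊢; omega)
      refine ⟨Walk.cons (induce_adj.2 ⟨Ne.symm hp, Or.inl rfl⟩) p, ?_⟩
      rw [Walk.length_cons]
      omega

/-- The clusters are the fibres of `par^[B]`. Paths through the root give diameter at most `2 * B`,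
and no forest edge leaves a fibre. -/
theorem isClusterTreeDeletion (h : G.IsParentMap par lev) (hB : ∀ v, lev v ≤ B) {d : ℝ}
    (hd : 2 * (B : ℝ) ≤ d) :
    IsClusterTreeDeletion G d (G.edgeSet \ (parentGraph par).edgeSet) := by
  have hle := h.parentGraph_le
  have hcl : ∀ S ∈ (Setoid.ker par^[B]).classes, ∃ x, ∃ _ : par^[B] x = x,
      S = {w | par^[B] w = x} := by
    rintro S ⟨y, rfl⟩
    refine ⟨par^[B] y, ?_, rfl⟩
    exact Function.iterate_fixed (h.par_iterate B y (hB y)) B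
  refine ⟨(Setoid.ker par^[B]).classes, parentGraph par,
    ⟨Setoid.isPartition_classes _, fun S hS => ?_⟩, hle, fun S hS => ?_, ?_⟩
  · obtain ⟨x, hx, rfl⟩ := hcl S hS
    have hw : ∀ v : {w | par^[B] w = x}, ∃ p : (G.induce {w | par^[B] w = x}).Walk v ⟨x, hx⟩,
        p.length ≤ B := by
      intro v
      obtain ⟨p, hp⟩ := h.exists_walk_root hB hx B v (hB v)
      exact ⟨p.mapLe (comap_monotone _ hle), (Walk.length_map _ _).trans_le hp⟩
    refine ⟨(connected_iff_exists_forall_reachable _).2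
      ⟨⟨x, hx⟩, fun v => (hw v).choose.reachable.symm⟩, fun u v => ?_⟩
    obtain ⟨p, hp⟩ := hw u
    obtain ⟨q, hq⟩ := hw v
    have h1 := dist_le (p.append q.reverse)
    rw [Walk.length_append, Walk.length_reverse] at h1
    have h2 : (G.induce {w | par^[B] w = x}).dist u v ≤ 2 * B := by omega
    exact le_trans (by exact_mod_cast h2) hd
  · obtain ⟨x, hx, rfl⟩ := hcl S hS
    refine (isTree_iff _).2 ⟨(connected_iff_exists_forall_reachable _).2
      ⟨⟨x, hx⟩, fun v => ?_⟩, h.isAcyclic.induce _⟩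
    exact (h.exists_walk_root hB hx B v (hB v)).choose.reachable.symm
  · have hTI : (parentGraph par).edgeSet ⊆ intraEdges G (Setoid.ker par^[B]).classes := by
      intro e
      induction e with | _ a b
      intro hab
      refine ⟨hle hab, {w | Setoid.ker par^[B] w a}, ⟨a, rfl⟩, fun x hx => ?_⟩
      rcases Sym2.mem_iff.1 hx with rfl | rfl
      · rfl
      · exact (h.iterate_eq_of_adj hB hab).symm
    have hIG : intraEdges G (Setoid.ker par^[B]).classes ⊆ G.edgeSet := fun e he => he.1
    unfold cutEdges
    ext e
    have h1 := @hTI e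
    have h2 := @hIG e
    simp only [Set.mem_union, Set.mem_sdiff]
    tauto

/-- The vertices other than the roots have an edge each. -/
theorem card_le [Finite V] (h : G.IsParentMap par lev) :
    Nat.card V ≤ (parentGraph par).edgeSet.ncard + {v | par v = v}.ncard := by
  have h1 : {v | par v = v}ᶜ.ncard ≤ (parentGraph par).edgeSet.ncard := by
    refine Set.ncard_le_ncard_of_injOn (fun v => s(v, par v)) (fun v hv => ?_) ?_
    · exact ⟨Ne.symm hv, Or.inl rfl⟩
    · intro v hv w hw hvw
      rcases Sym2.eq_iff.1 hvw with ⟨h1, -⟩ | ⟨h1, h2⟩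
      · exact h1
      · have h3 := (h v hv).2
        have h4 := (h w hw).2
        rw [h2] at h3
        rw [← h1] at h4
        omega
  have h2 := Set.ncard_add_ncard_compl {v | par v = v}
  omega

/-- An optimal deletion leaves at most vertices minus components many edges, and the parent forest
has at least vertices minus roots. The excess, roots minus components, is paid for by the `ρ` edges
that each surplus root owns. -/
theorem ncard_diff_le [Finite V] (h : G.IsParentMap par lev) {ρ : ℕ} {ε : ℝ} (hρ : 1 ≤ ε * ρ)
    (hε : 0 < ε)
    (hS : ∀ u v, par u = u → par v = v → u ≠ v → ∀ p : G.Walk u v, 2 * ρ < p.length) :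
    ((G.edgeSet \ (parentGraph par).edgeSet).ncard : ℝ) ≤
      (deletionDist CycleFree.{u} G : ℝ) + ε * (G.edgeSet.ncard : ℝ) := by
  -- Nonemptiness ensures that the infimum defining `deletionDist` is attained by some `D`.
  have hne : {k : ℕ | ∃ D : Set (Sym2 V), D ⊆ G.edgeSet ∧ CycleFree V (G.deleteEdges D) ∧
      D.ncard = k}.Nonempty := by
    refine ⟨_, G.edgeSet \ (parentGraph par).edgeSet, Set.sdiff_subset, ?_, rfl⟩
    refine h.isAcyclic.anti fun a b hab => ?_
    rw [deleteEdges_adj] at hab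
    by_contra hn
    exact hab.2 ⟨hab.1, hn⟩
  obtain ⟨D, hD, hac, hDk⟩ := Nat.sInf_mem hne
  have hDk' : D.ncard = deletionDist CycleFree.{u} G := hDk
  have h1 := IsAcyclic.ncard_edgeSet_add_card_le hac
  have h2 := Nat.card_le_card_of_surjective _
    (ConnectedComponent.surjective_map_ofLE (G.deleteEdges_le D))
  have h3 := h.card_le
  have h4 := ncard_mul_le_of_separated (S := {v | par v = v}) (ρ := ρ)
    (fun u hu v hv => hS u v hu hv)
  rw [edgeSet_deleteEdges] at h1
  have h5 := Set.ncard_sdiff_add_ncard_of_subset hD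
  have h6 := Set.ncard_sdiff_add_ncard_of_subset (edgeSet_mono h.parentGraph_le)
  have h7 : (G.edgeSet \ (parentGraph par).edgeSet).ncard ≤ D.ncard +
    ({v | par v = v}.ncard - Nat.card G.ConnectedComponent) := by omega
  rw [← hDk']
  generalize {v | par v = v}.ncard - Nat.card G.ConnectedComponent = x at h4 h7
  have h8 : ((x * ρ : ℕ) : ℝ) ≤ G.edgeSet.ncard := Nat.cast_le.2 h4
  have h9 : ((G.edgeSet \ (parentGraph par).edgeSet).ncard : ℝ) ≤ D.ncard + x := by
    exact_mod_cast h7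
  push_cast at h8
  have h10 : (x : ℝ) ≤ ε * (x * ρ) := by
    have := mul_le_mul_of_nonneg_left hρ (Nat.cast_nonneg (α := ℝ) x)
    linarith
  have h11 := mul_le_mul_of_nonneg_left h8 hε.le
  linarith

end IsParentMap
end SimpleGraph

/-! ### Ruling sets -/

namespace SimpleGraph

variable {V : Type u} {G : SimpleGraph V}

/-- One bit of the identifiers after the other, the candidates whose bit is `1` and which are at
distance at most `r` from a candidate whose bit is `0` are discarded. -/
def rulingSet (G : SimpleGraph V) (ident : V → ℕ) (r : ℕ) : ℕ → Set V
  | 0 => Set.univ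
  | j + 1 => {v ∈ G.rulingSet ident r j | (ident v).testBit j = false ∨
      v ∉ G.within {u ∈ G.rulingSet ident r j | (ident u).testBit j = false} r}

variable {ident : V → ℕ} {r : ℕ}

theorem rulingSet_antitone : Antitone (G.rulingSet ident r) :=
  antitone_nat_of_succ_le fun _ _ hv => hv.1

/-- The identifiers of two survivors differ in some bit `j < L`. At stage `j` the one with bit `1`
would have been discarded had the other been within distance `r`. -/
theorem rulingSet_separated {L : ℕ} (hinj : Function.Injective ident)
    (hL : ∀ v, ident v < 2 ^ L) {u v : V} (hu : u ∈ G.rulingSet ident r L)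
    (hv : v ∈ G.rulingSet ident r L) (huv : u ≠ v) (p : G.Walk u v) : r < p.length := by
  have key : ∀ {u v : V} (p : G.Walk u v), u ∈ G.rulingSet ident r L →
      v ∈ G.rulingSet ident r L → ∀ j < L, (ident u).testBit j = true →
      (ident v).testBit j = false → r < p.length := by
    intro u v p hu hv j hj hju hjv
    by_contra hlen
    rcases (rulingSet_antitone (Nat.succ_le_of_lt hj) hu).2 with h | h
    · rw [hju] at h
      exact absurd h (by decide)
    · exact h (within_mono _ (not_lt.1 hlen)
        (p.mem_within ⟨rulingSet_antitone hj.le hv, hjv⟩))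
  have hne : ∃ j, (ident u).testBit j ≠ (ident v).testBit j := by
    by_contra hcon
    push Not at hcon
    exact huv (hinj (Nat.eq_of_testBit_eq hcon))
  obtain ⟨j, hj⟩ := hne
  have hjL : j < L := by
    by_contra hjL
    have hpow : 2 ^ L ≤ 2 ^ j := Nat.pow_le_pow_right two_pos (not_lt.1 hjL)
    exact hj (by rw [Nat.testBit_lt_two_pow ((hL u).trans_le hpow),
      Nat.testBit_lt_two_pow ((hL v).trans_le hpow)])
  cases hu' : (ident u).testBit j <;> cases hv' : (ident v).testBit j
  · exact absurd (hu'.trans hv'.symm) hj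
  · have := key p.reverse hv hu j hjL hv' hu'
    rwa [Walk.length_reverse] at this
  · exact key p hu hv j hjL hu' hv'
  · exact absurd (hu'.trans hv'.symm) hj

/-- A candidate discarded at a stage is within `r` of a candidate with bit `0`, which survives that
stage. Thus the covering radius grows by at most `r` per stage. -/
theorem mem_within_rulingSet (v : V) (L : ℕ) :
    v ∈ G.within (G.rulingSet ident r L) (L * r) := by
  induction L with
  | zero => rw [Nat.zero_mul]; trivial
  | succ L ih =>
    rw [Nat.succ_mul, add_comm (L * r) r, ← within_within]
    have hsub : G.rulingSet ident r L ⊆ G.within (G.rulingSet ident r (L + 1)) r := by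
      intro u hu
      by_cases h : (ident u).testBit L = false ∨
          u ∉ G.within {w ∈ G.rulingSet ident r L | (ident w).testBit L = false} r
      · have hu' : u ∈ G.rulingSet ident r (L + 1) := ⟨hu, h⟩
        exact within_mono _ (Nat.zero_le r) hu'
      · push Not at h
        have hle : {w ∈ G.rulingSet ident r L | (ident w).testBit L = false} ⊆
            G.rulingSet ident r (L + 1) := fun w hw => ⟨hw.1, Or.inl hw.2⟩
        exact within_subset_within hle _ h.2
    exact within_subset_within hsub _ ih

end SimpleGraph

/-! ### The algorithm -/

/-- The state of a processor: the current phase and the number of rounds in it, the identifier and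
the degree, whether the processor is still a candidate, whether the current flood has reached it,
the port of its parent in the flood and the ports of its children. -/
structure CorrectorState where
  phase : ℕ
  step : ℕ
  ident : ℕ
  degree : ℕ
  cand : Bool
  token : Bool
  parent : Option ℕ
  child : ℕ → Bool

/-- Does a processor start the flood of phase `j`? In the phases before phase `L` these are the
candidates whose `j`-th bit is `0`, in the last phase all the remaining candidates. -/
def startsFlood (L j ident : ℕ) (cand : Bool) : Bool :=
  cand && (decide (L ≤ j) || !ident.testBit j)

/-- The first port with a message from a processor which the flood has reached. -/
def firstPort (degree : ℕ) (inbox : ℕ → List Bool) : Option ℕ :=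
  (List.range degree).find? fun p => (inbox p).getD 0 false

/-- The step of a processor in one round. -/
def CorrectorState.next (L r : ℕ) (s : CorrectorState) (inbox : ℕ → List Bool) :
    CorrectorState :=
  -- After `r` flooding rounds, one round ignores the messages, discards candidates and starts the
  -- next flood. Phase `L` has no such round.
  if s.phase < L ∧ s.step = r then
    { s with
      phase := s.phase + 1
      step := 0
      cand := s.cand && (!s.ident.testBit s.phase || !s.token)
      token := startsFlood L (s.phase + 1) s.ident
        (s.cand && (!s.ident.testBit s.phase || !s.token))
      parent := none }
  else
    { s with
      step := s.step + 1
      token := s.token || (firstPort s.degree inbox).isSome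
      parent := if s.token then s.parent else firstPort s.degree inbox
      -- This is overwritten in every flooding round; only its value after the final round matters.
      child := fun p => (inbox p).getD 1 false }

/-- In `L` phases of `r + 1` rounds a ruling set is computed from the bits of the identifiers. Then
breadth-first trees grow from its elements, and the edges outside of these trees are deleted. -/
def corrector (L r : ℕ) : CongestAlgorithm where
  tapeLength := 0
  State := CorrectorState
  init ident degree _ :=
    { phase := 0, step := 0, ident := ident, degree := degree, cand := true,
      token := startsFlood L 0 ident true, parent := none, child := fun _ => false }
  send s p := [s.token, decide (s.parent = some p)]
  receive := CorrectorState.next L r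
  -- The last flood needs `L * r` rounds, the covering radius of the ruling set; one more round
  -- tells parents about their children.
  rounds := L * (r + 1) + L * r + 1
  output s p := !(decide (s.parent = some p) || s.child p)

theorem firstPort_isSome {degree : ℕ} {inbox : ℕ → List Bool} :
    (firstPort degree inbox).isSome = true ↔ ∃ p < degree, (inbox p).getD 0 false = true := by
  simp [firstPort]

theorem firstPort_eq_some {degree : ℕ} {inbox : ℕ → List Bool} {p : ℕ}
    (h : firstPort degree inbox = some p) : p < degree ∧ (inbox p).getD 0 false = true :=
  ⟨List.mem_range.1 (List.mem_of_find?_eq_some h),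
    List.find?_some (p := fun p => (inbox p).getD 0 false) h⟩

/-! ### Correctness of the floods -/

namespace Network

variable {V : Type u} (N : Network V)

theorem inbox_port (out : V → ℕ → List Bool) (v : V) (p : Fin (N.graph.neighborSet v).ncard) :
    N.inbox out v p =
      out (N.port v p) ((N.port (N.port v p)).symm ⟨v, (N.port v p).2.symm⟩ : Fin _) := by
  unfold inbox
  rw [dif_pos p.2]

/-- The processors at which the flood of phase `j` starts. -/
def floodSources (L r j : ℕ) : Set V :=
  {v ∈ N.graph.rulingSet N.ident r j | L ≤ j ∨ (N.ident v).testBit j = false}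

/-- The states after `i` rounds of phase `j`. -/
structure FloodInvariant (L r j i : ℕ) (σ : V → CorrectorState) (v : V) : Prop where
  phase : (σ v).phase = j
  step : (σ v).step = i
  ident : (σ v).ident = N.ident v
  degree : (σ v).degree = (N.graph.neighborSet v).ncard
  cand : (σ v).cand = true ↔ v ∈ N.graph.rulingSet N.ident r j
  token : (σ v).token = true ↔ v ∈ N.graph.within (N.floodSources L r j) i
  -- A reached vertex without a parent is a source. Otherwise some time `k` separates the vertex
  -- from its parent, which was reached earlier; this persists as `i` grows.
  parent : ((σ v).parent = none ∧
      (v ∈ N.graph.within (N.floodSources L r j) i → v ∈ N.floodSources L r j)) ∨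
    ∃ p : Fin (N.graph.neighborSet v).ncard, (σ v).parent = some (p : ℕ) ∧
      ∃ k, v ∉ N.graph.within (N.floodSources L r j) k ∧
        (N.port v p : V) ∈ N.graph.within (N.floodSources L r j) k

variable {N} {L r : ℕ}

theorem startsFlood_iff {j : ℕ} {v : V} {cand : Bool}
    (h : cand = true ↔ v ∈ N.graph.rulingSet N.ident r j) :
    startsFlood L j (N.ident v) cand = true ↔ v ∈ N.floodSources L r j := by
  simp [startsFlood, floodSources, h, and_or_left]

/-- The states after one more round. -/
noncomputable def nextStates (N : Network V) (L r : ℕ) (σ : V → CorrectorState) (v : V) :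
    CorrectorState :=
  (corrector L r).receive (σ v) (N.inbox (fun u => (corrector L r).send (σ u)) v)

theorem floodInvariant_init (tape : V → Fin (corrector L r).tapeLength → Bool) (v : V) :
    N.FloodInvariant L r 0 0 ((corrector L r).stateAfter N tape 0) v where
  phase := rfl
  step := rfl
  ident := rfl
  degree := rfl
  cand := ⟨fun _ => Set.mem_univ v, fun _ => rfl⟩
  token := startsFlood_iff (N := N) (r := r) ⟨fun _ => Set.mem_univ v, fun _ => rfl⟩
  parent := Or.inl ⟨rfl, id⟩

theorem FloodInvariant.reset {j : ℕ} {σ : V → CorrectorState} {v : V}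
    (h : N.FloodInvariant L r j r σ v) (hj : j < L) :
    N.FloodInvariant L r (j + 1) 0 (N.nextStates L r σ) v := by
  have hif : (σ v).phase < L ∧ (σ v).step = r := ⟨h.phase ▸ hj, h.step⟩
  -- Before phase `L` the sources are the candidates with bit `0`, so holding the token after `r`
  -- rounds is exactly the distance test in `rulingSet`.
  have hX : N.floodSources L r j =
      {u ∈ N.graph.rulingSet N.ident r j | (N.ident u).testBit j = false} := by
    simp [floodSources, hj]
  have hcand : ((σ v).cand && (!(σ v).ident.testBit (σ v).phase || !(σ v).token)) = true ↔
      v ∈ N.graph.rulingSet N.ident r (j + 1) := by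
    have ht := h.token
    rw [hX] at ht
    rw [Bool.and_eq_true, Bool.or_eq_true, h.cand, h.ident, h.phase, Bool.not_eq_true',
      Bool.not_eq_true', ← Bool.not_eq_true (σ v).token, ht]
    rfl
  have hs : N.nextStates L r σ v = _ := if_pos hif
  constructor
  · rw [hs]; exact congrArg (· + 1) h.phase
  · rw [hs]
  · rw [hs]; exact h.ident
  · rw [hs]; exact h.degree
  · rw [hs]; exact hcand
  · rw [hs, h.phase, h.ident] at *
    exact startsFlood_iff hcand
  · exact Or.inl ⟨by rw [hs], id⟩

theorem FloodInvariant.flood {j i : ℕ} {σ : V → CorrectorState}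
    (h : ∀ v, N.FloodInvariant L r j i σ v) (hji : ¬(j < L ∧ i = r)) (v : V) :
    N.FloodInvariant L r j (i + 1) (N.nextStates L r σ) v := by
  have hif : ¬((σ v).phase < L ∧ (σ v).step = r) := by rwa [(h v).phase, (h v).step]
  have hs : N.nextStates L r σ v = _ := if_neg hif
  have hin : ∀ p : Fin (N.graph.neighborSet v).ncard,
      (N.inbox (fun u => (corrector L r).send (σ u)) v p).getD 0 false = true ↔
        (N.port v p : V) ∈ N.graph.within (N.floodSources L r j) i := by
    intro p
    rw [inbox_port, ← (h _).token]
    rfl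
  have hhear : (firstPort (σ v).degree (N.inbox (fun u => (corrector L r).send (σ u)) v)).isSome
      = true ↔ ∃ w, N.graph.Adj v w ∧ w ∈ N.graph.within (N.floodSources L r j) i := by
    rw [firstPort_isSome, (h v).degree]
    constructor
    · rintro ⟨p, hp, hpm⟩
      exact ⟨N.port v ⟨p, hp⟩, (N.port v ⟨p, hp⟩).2, (hin ⟨p, hp⟩).1 hpm⟩
    · rintro ⟨w, hw, hwm⟩
      refine ⟨((N.port v).symm ⟨w, hw⟩ : Fin _), ((N.port v).symm ⟨w, hw⟩).2, ?_⟩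
      rw [hin, Equiv.apply_symm_apply]
      exact hwm
  constructor
  · rw [hs]; exact (h v).phase
  · rw [hs]; exact congrArg (· + 1) (h v).step
  · rw [hs]; exact (h v).ident
  · rw [hs]; exact (h v).degree
  · rw [hs]; exact (h v).cand
  · rw [hs, Bool.or_eq_true, (h v).token, hhear]
    rfl
  · have hpar : (N.nextStates L r σ v).parent = if (σ v).token then (σ v).parent else
        firstPort (σ v).degree (N.inbox (fun u => (corrector L r).send (σ u)) v) := by rw [hs]
    by_cases ht : v ∈ N.graph.within (N.floodSources L r j) i
    · rw [hpar, if_pos ((h v).token.2 ht)]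
      rcases (h v).parent with ⟨h1, h2⟩ | h1
      · exact Or.inl ⟨h1, fun _ => h2 ht⟩
      · exact Or.inr h1
    · rw [hpar, if_neg (fun h' => ht ((h v).token.1 h'))]
      cases hf : firstPort (σ v).degree (N.inbox (fun u => (corrector L r).send (σ u)) v) with
      | none =>
        rw [hf] at hhear
        refine Or.inl ⟨rfl, ?_⟩
        rintro (h1 | h1)
        · exact absurd h1 ht
        · exact absurd (hhear.2 h1) (by simp)
      | some p =>
        obtain ⟨h1, h2⟩ := firstPort_eq_some hf
        rw [(h v).degree] at h1
        exact Or.inr ⟨⟨p, h1⟩, rfl, i, ht, (hin ⟨p, h1⟩).1 h2⟩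

theorem floodInvariant_stateAfter (tape : V → Fin (corrector L r).tapeLength → Bool) (j : ℕ) :
    ∀ i, j ≤ L → (j < L → i ≤ r) → ∀ v, N.FloodInvariant L r j i
      ((corrector L r).stateAfter N tape (j * (r + 1) + i)) v := by
  induction j with
  | zero =>
    intro i
    rw [Nat.zero_mul, Nat.zero_add]
    induction i with
    | zero => exact fun _ _ => floodInvariant_init tape
    | succ i ih =>
      exact fun hj hi => FloodInvariant.flood (ih hj fun h => by have := hi h; omega)
        (fun h => by have := hi h.1; omega)
  | succ j ihj =>
    intro i
    induction i with
    | zero =>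
      intro hj _ v
      rw [Nat.succ_mul, Nat.add_zero, ← Nat.add_assoc]
      exact (ihj r (by omega) (fun _ => le_rfl) v).reset (by omega)
    | succ i ih =>
      exact fun hj hi => FloodInvariant.flood (ih hj fun h => by have := hi h; omega)
        (fun h => by have := hi h.1; omega)

/-- The first round of the flood in which a processor is reached. -/
noncomputable def floodLevel (N : Network V) (L r : ℕ) (v : V) : ℕ :=
  sInf {k | v ∈ N.graph.within (N.floodSources L r L) k}

/-- The parent of a processor, or the processor itself if it has none. -/
noncomputable def parentOf (N : Network V) (σ : V → CorrectorState) (v : V) : V :=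
  match (σ v).parent with
  | none => v
  | some p => if h : p < (N.graph.neighborSet v).ncard then N.port v ⟨p, h⟩ else v

theorem parentOf_eq_port_iff {σ : V → CorrectorState} {v : V}
    (p : Fin (N.graph.neighborSet v).ncard) :
    N.parentOf σ v = N.port v p ↔ (σ v).parent = some (p : ℕ) := by
  have hne : v ≠ N.port v p := fun h => N.graph.ne_of_adj (N.port v p).2 h
  unfold parentOf
  cases (σ v).parent with
  | none => simpa using hne
  | some q =>
    by_cases hq : q < (N.graph.neighborSet v).ncard
    · simp only [dif_pos hq, Option.some.injEq]
      rw [Subtype.val_inj, (N.port v).injective.eq_iff, Fin.ext_iff]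
    · simp only [dif_neg hq, Option.some.injEq]
      exact ⟨fun h => absurd h hne, fun h => absurd (h ▸ p.2) hq⟩

/-! ### From the final states to the forest -/

variable {σ : V → CorrectorState}

theorem FloodInvariant.isParentMap (h : ∀ v, N.FloodInvariant L r L (L * r) σ v) :
    N.graph.IsParentMap (N.parentOf σ) (N.floodLevel L r) := by
  intro v hv
  rcases (h v).parent with ⟨h1, -⟩ | ⟨p, hp, k, hk1, hk2⟩
  · exact absurd (by simp [parentOf, h1]) hv
  · rw [(parentOf_eq_port_iff p).2 hp]
    refine ⟨(N.port v p).2, lt_of_le_of_lt (Nat.sInf_le hk2) ?_⟩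
    -- Covering makes the set of admissible times nonempty, so its infimum is attained; the
    -- separating time `k` then lies strictly below the level of `v`.
    have hmem : v ∈ N.graph.within (N.floodSources L r L) (N.floodLevel L r v) :=
      Nat.sInf_mem (s := {k | v ∈ N.graph.within (N.floodSources L r L) k})
        ⟨L * r, by simpa [floodSources] using SimpleGraph.mem_within_rulingSet v L⟩
    by_contra hlt
    exact hk1 (SimpleGraph.within_mono _ (not_lt.1 hlt) hmem)

theorem floodLevel_le (v : V) : N.floodLevel L r v ≤ L * r :=
  Nat.sInf_le (by simpa [floodSources] using SimpleGraph.mem_within_rulingSet v L)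

theorem FloodInvariant.mem_rulingSet (h : ∀ v, N.FloodInvariant L r L (L * r) σ v) {v : V}
    (hv : N.parentOf σ v = v) : v ∈ N.graph.rulingSet N.ident r L := by
  rcases (h v).parent with ⟨-, h2⟩ | ⟨p, hp, -⟩
  · exact (h2 (by simpa [floodSources] using SimpleGraph.mem_within_rulingSet v L)).1
  · rw [(parentOf_eq_port_iff p).2 hp] at hv
    exact absurd hv.symm (N.graph.ne_of_adj (N.port v p).2)

/-- Every vertex already holds the token, so parents are frozen in this round. The second message
bit tells each end of an edge whether it is the parent of the other, hence both ends decide alike.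
-/
theorem output_nextStates (h : ∀ v, N.FloodInvariant L r L (L * r) σ v) (v : V)
    (p : Fin (N.graph.neighborSet v).ncard) :
    (corrector L r).output (N.nextStates L r σ v) p = true ↔
      s(v, (N.port v p : V)) ∈
        N.graph.edgeSet \ (SimpleGraph.parentGraph (N.parentOf σ)).edgeSet := by
  have hif : ¬((σ v).phase < L ∧ (σ v).step = r) := by
    rw [(h v).phase]
    omega
  have hs : N.nextStates L r σ v = _ := if_neg hif
  have htok : (σ v).token = true :=
    (h v).token.2 (by simpa [floodSources] using SimpleGraph.mem_within_rulingSet v L)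
  have hpar : (N.nextStates L r σ v).parent = (σ v).parent := by
    rw [hs]
    exact if_pos htok
  have hchild : (N.nextStates L r σ v).child p = true ↔ N.parentOf σ (N.port v p) = v := by
    have hin := N.inbox_port (fun u => (corrector L r).send (σ u)) v p
    rw [hs]
    change (N.inbox (fun u => (corrector L r).send (σ u)) v p).getD 1 false = true ↔ _
    rw [hin]
    have h1 := parentOf_eq_port_iff (N := N) (σ := σ)
      ((N.port (N.port v p)).symm ⟨v, (N.port v p).2.symm⟩)
    rw [Equiv.apply_symm_apply] at h1
    rw [h1]
    exact decide_eq_true_iff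
  have hne : v ≠ N.port v p := N.graph.ne_of_adj (N.port v p).2
  change (!(decide ((N.nextStates L r σ v).parent = some (p : ℕ)) ||
    (N.nextStates L r σ v).child p)) = true ↔ _
  rw [Bool.not_eq_true', ← Bool.not_eq_true, Bool.or_eq_true, decide_eq_true_iff, hpar, hchild,
    ← parentOf_eq_port_iff]
  constructor
  · rintro h1
    exact ⟨(N.port v p).2, fun h2 => h1 h2.2⟩
  · rintro ⟨-, h1⟩ h2
    exact h1 ⟨hne, h2⟩

end Network

/-! ### The theorem -/

theorem CongestAlgorithm.tapeProb_eq_one {V : Type u} [Finite V] (A : CongestAlgorithm)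
    {event : Set (V → Fin A.tapeLength → Bool)} (h : ∀ tape, tape ∈ event) :
    A.tapeProb event = 1 := by
  unfold tapeProb
  rw [Set.eq_univ_of_forall h, Set.ncard_univ]
  exact div_self (Nat.cast_ne_zero.2 Nat.card_pos.ne')

/-- The algorithm without communication that deletes every edge. -/
def deleteAll : CongestAlgorithm where
  tapeLength := 0
  State := Unit
  init _ _ _ := ()
  send _ _ := []
  receive _ _ := ()
  rounds := 0
  output _ _ := true

/-- With fewer than two vertices there are no edges, and with `1 ≤ ε` all edges may be deleted. The
identity as parent map gives singleton clusters. -/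
theorem deleteAll_corrects {V : Type u} [Finite V] (N : Network V) {ε d : ℝ}
    (h : Nat.card V < 2 ∨ 1 ≤ ε) (hd : 0 ≤ d) (tape : V → Fin deleteAll.tapeLength → Bool) :
    deleteAll.Corrects N CycleFree.{u} ε tape N.graph.edgeSet ∧
      IsClusterTreeDeletion N.graph d N.graph.edgeSet := by
  have hpar : N.graph.IsParentMap id fun _ => 0 := fun v hv => absurd rfl hv
  have hbot : SimpleGraph.parentGraph (id : V → V) = ⊥ := by
    rw [eq_bot_iff]
    rintro v w ⟨hne, h | h⟩
    · exact hne h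
    · exact hne h.symm
  have hD : N.graph.edgeSet \ (SimpleGraph.parentGraph (id : V → V)).edgeSet =
      N.graph.edgeSet := by
    rw [hbot, SimpleGraph.edgeSet_bot, Set.sdiff_empty]
  refine ⟨⟨subset_rfl, fun v i => ⟨fun _ => (N.port v i).2, fun _ => rfl⟩, ?_, ?_⟩, ?_⟩
  · have : N.graph.deleteEdges N.graph.edgeSet = ⊥ := by
      rw [eq_bot_iff]
      intro v w hvw
      rw [SimpleGraph.deleteEdges_adj] at hvw
      exact hvw.2 hvw.1
    rw [this, ← hbot]
    exact hpar.isAcyclic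
  · have hE : (N.graph.edgeSet.ncard : ℝ) ≤ ε * N.graph.edgeSet.ncard := by
      rcases h with h | h
      · have : Subsingleton V := (Finite.card_le_one_iff_subsingleton).1 (by omega)
        rw [Subsingleton.elim N.graph ⊥]
        simp
      · exact le_mul_of_one_le_left (Nat.cast_nonneg _) h
    exact hE.trans (le_add_of_nonneg_left (Nat.cast_nonneg _))
  · rw [← hD]
    exact hpar.isClusterTreeDeletion (B := 0) (fun _ => le_rfl) (by simpa using hd)

theorem corrector_corrects {V : Type u} [Finite V] (N : Network V) {L ρ : ℕ} {ε d : ℝ}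
    (hε : 0 < ε) (hρ : 1 ≤ ε * ρ) (hL : ∀ v, N.ident v < 2 ^ L)
    (hd : 2 * ((L * (2 * ρ) : ℕ) : ℝ) ≤ d)
    (tape : V → Fin (corrector L (2 * ρ)).tapeLength → Bool) :
    ∃ D, (corrector L (2 * ρ)).Corrects N CycleFree.{u} ε tape D ∧
      IsClusterTreeDeletion N.graph d D := by
  have h := N.floodInvariant_stateAfter tape L (L * (2 * ρ)) le_rfl
    (fun h => absurd h (lt_irrefl _))
  have hpar := Network.FloodInvariant.isParentMap h
  refine ⟨_, ⟨Set.sdiff_subset, Network.output_nextStates h, ?_, ?_⟩,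
    hpar.isClusterTreeDeletion Network.floodLevel_le hd⟩
  · refine hpar.isAcyclic.anti fun a b hab => ?_
    rw [SimpleGraph.deleteEdges_adj] at hab
    by_contra hn
    exact hab.2 ⟨hab.1, hn⟩
  · exact hpar.ncard_diff_le hρ hε fun u v hu hv huv p =>
      SimpleGraph.rulingSet_separated N.ident_injective hL
        (Network.FloodInvariant.mem_rulingSet h hu) (Network.FloodInvariant.mem_rulingSet h hv)
        huv p

theorem natLog_succ_le {n : ℕ} (hn : 2 ≤ n) :
    ((Nat.log 2 n + 1 : ℕ) : ℝ) ≤ 4 * Real.log n ∧ 1 ≤ 2 * Real.log n := by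
  have h2 := Real.log_two_gt_d9
  have hlog : Real.log 2 ≤ Real.log n :=
    Real.log_le_log two_pos (by exact_mod_cast hn)
  have h1 : ((2 ^ Nat.log 2 n : ℕ) : ℝ) ≤ n :=
    Nat.cast_le.2 (Nat.pow_log_le_self 2 (by omega))
  have h3 := Real.log_le_log (by positivity) h1
  push_cast at h3 ⊢
  rw [Real.log_pow] at h3
  -- Since `log 2 > 1/2`, this gives `Nat.log 2 n ≤ 2 log n`; the summand `1` costs another `2 log
  -- n`.
  have h4 : (Nat.log 2 n : ℝ) * (1 / 2) ≤ Nat.log 2 n * Real.log 2 :=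
    mul_le_mul_of_nonneg_left (by linarith) (Nat.cast_nonneg _)
  constructor <;> linarith

theorem ceil_inv_bounds {ε : ℝ} (hε : 0 < ε) (hε1 : ε < 1) :
    1 ≤ ε * (⌈1 / ε⌉₊ : ℝ) ∧ (⌈1 / ε⌉₊ : ℝ) ≤ 2 / ε := by
  constructor
  · have := mul_le_mul_of_nonneg_left (Nat.le_ceil (1 / ε)) hε.le
    rwa [mul_one_div_cancel hε.ne'] at this
  · have h1 := (Nat.ceil_lt_add_one (one_div_pos.2 hε).le).le
    have h2 : 1 ≤ 1 / ε := by rw [le_div_iff₀ hε]; linarith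
    have h3 : 2 / ε = 1 / ε + 1 / ε := by ring
    linarith

open Classical in
/-- The algorithm for `n` processors with identifiers below `n ^ κ`. -/
noncomputable def cycleFreeCorrector (κ n : ℕ) (ε : ℝ) : CongestAlgorithm :=
  -- For `n < 2` the bounds on rounds and bits are `0`, and for large `ε` the bound on rounds falls
  -- below `1`; only a silent algorithm without rounds meets them.
  if 2 ≤ n ∧ ε < 1 then corrector (κ * (Nat.log 2 n + 1)) (2 * ⌈1 / ε⌉₊) else deleteAll

theorem mainTheorem3 (κ c : ℕ) :
    ∃ C : ℝ, 0 < C ∧ ∃ A : ℕ → ℝ → CongestAlgorithm,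
      ∀ (n : ℕ) (ε : ℝ), 0 < ε →
        ((A n ε).rounds : ℝ) ≤ C * (Real.log n / ε) ∧
        (A n ε).BandwidthAtMost (C * Real.log n) ∧
        ∀ (V : Type u) [Finite V] (N : Network V), Nat.card V = n →
          (∀ v, N.ident v < n ^ κ) →
          1 - 1 / (n : ℝ) ^ c ≤
            (A n ε).tapeProb {tape | ∃ D : Set (Sym2 V),
              (A n ε).Corrects N CycleFree ε tape D ∧
              IsClusterTreeDeletion N.graph (C * (Real.log n / ε)) D} := by
  -- With `L ≤ 4 κ log n` and `r ≤ 4 / ε`, the product `L * r` is at most `16 κ log n / ε`. There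
  -- are at most `3 * (L * r) + 1` rounds, because `r + 1 ≤ 2 * r`, which gives `48 κ`. The `4`
  -- absorbs the extra round and the two bits of a message, as `1 ≤ 2 log n`.
  have hC : (0 : ℝ) < 48 * κ + 4 := by positivity
  refine ⟨48 * κ + 4, hC, cycleFreeCorrector κ, fun n ε hε => ?_⟩
  have hlog : 0 ≤ Real.log n := Real.log_natCast_nonneg n
  suffices hmain : ((cycleFreeCorrector κ n ε).rounds : ℝ) ≤
        (48 * κ + 4) * (Real.log n / ε) ∧
      (cycleFreeCorrector κ n ε).BandwidthAtMost ((48 * κ + 4) * Real.log n) ∧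
      ∀ (V : Type u) [Finite V] (N : Network V), Nat.card V = n → (∀ v, N.ident v < n ^ κ) →
        ∀ tape, ∃ D : Set (Sym2 V), (cycleFreeCorrector κ n ε).Corrects N CycleFree ε tape D ∧
          IsClusterTreeDeletion N.graph ((48 * κ + 4) * (Real.log n / ε)) D by
    refine ⟨hmain.1, hmain.2.1, fun V _ N hV hid => ?_⟩
    refine le_of_le_of_eq (sub_le_self _ (by positivity))
      (CongestAlgorithm.tapeProb_eq_one _ fun tape => ?_).symm
    exact hmain.2.2 V N hV hid tape
  by_cases hcase : 2 ≤ n ∧ ε < 1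
  · rw [show cycleFreeCorrector κ n ε = _ from if_pos hcase]
    obtain ⟨hn, hε1⟩ := hcase
    obtain ⟨hlog1, hlog2⟩ := natLog_succ_le hn
    obtain ⟨hρ1, hρ2⟩ := ceil_inv_bounds hε hε1
    have hlogε : Real.log n ≤ Real.log n / ε := by
      rw [le_div_iff₀ hε]
      exact mul_le_of_le_one_right hlog hε1.le
    have hprod : ((κ * (Nat.log 2 n + 1) * (2 * ⌈1 / ε⌉₊) : ℕ) : ℝ) ≤
        16 * κ * (Real.log n / ε) := by
      have h1 := mul_le_mul (mul_le_mul_of_nonneg_left hlog1 (Nat.cast_nonneg (α := ℝ) κ))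
        (mul_le_mul_of_nonneg_left hρ2 zero_le_two) (by positivity) (by positivity)
      push_cast at h1 ⊢
      exact h1.trans_eq (by ring)
    have hρpos : 1 ≤ ⌈1 / ε⌉₊ := Nat.ceil_pos.2 (one_div_pos.2 hε)
    refine ⟨?_, ?_, fun V _ N hV hid tape => ?_⟩
    · have hr : (corrector (κ * (Nat.log 2 n + 1)) (2 * ⌈1 / ε⌉₊)).rounds ≤
          3 * (κ * (Nat.log 2 n + 1) * (2 * ⌈1 / ε⌉₊)) + 1 := by
        have h1 : κ * (Nat.log 2 n + 1) * (2 * ⌈1 / ε⌉₊ + 1) ≤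
            κ * (Nat.log 2 n + 1) * (2 * (2 * ⌈1 / ε⌉₊)) :=
          Nat.mul_le_mul_left _ (by omega)
        rw [Nat.mul_left_comm] at h1
        change κ * (Nat.log 2 n + 1) * (2 * ⌈1 / ε⌉₊ + 1) +
          κ * (Nat.log 2 n + 1) * (2 * ⌈1 / ε⌉₊) + 1 ≤ _
        omega
      have hr' := Nat.cast_le (α := ℝ).2 hr
      rw [Nat.cast_add, Nat.cast_mul 3] at hr'
      push_cast at hr' hprod
      linarith
    · intro s p
      have h1 : 0 ≤ (κ : ℝ) * Real.log n := by positivity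
      change ((2 : ℕ) : ℝ) ≤ _
      push_cast
      linarith
    · refine corrector_corrects N hε hρ1 (fun v => (hid v).trans_le ?_) ?_ tape
      · rw [Nat.mul_comm, pow_mul]
        exact Nat.pow_le_pow_left (Nat.lt_pow_succ_log_self one_lt_two n).le κ
      · have h1 : 0 ≤ (κ : ℝ) * (Real.log n / ε) := by positivity
        linarith
  · rw [show cycleFreeCorrector κ n ε = _ from if_neg hcase]
    have hcase' : n < 2 ∨ 1 ≤ ε := by
      rcases not_and_or.1 hcase with h | h
      · exact Or.inl (not_le.1 h)
      · exact Or.inr (not_lt.1 h)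
    refine ⟨?_, ?_, fun V _ N hV hid tape => ⟨_, deleteAll_corrects N (hV ▸ hcase') ?_ tape⟩⟩
    · change ((0 : ℕ) : ℝ) ≤ _
      rw [Nat.cast_zero]
      positivity
    · intro s p
      change ((0 : ℕ) : ℝ) ≤ _
      rw [Nat.cast_zero]
      positivity
    · positivity
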